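/- Fix the computational basis $|0\rangle,|1\rangle$ of a qubit and the product basis $|i\rangle\otimes|j\rangle$ of two qubits. A state is a positive semidefinite matrix of trace one; it is incoherent if it is diagonal in the fixed basis. An incoherent operation is a map $\Lambda_i[X]=\sum_k K_kXK_k^\dagger$ (finite sum) with $\sum_k K_k^\dagger K_k=\mathbb 1$ such that, for every $k$ and every incoherent state $\delta$, the matrix $K_k\delta K_k^\dagger$ is diagonal. Let $C(\rho)=\sum_{i\neq j}|\rho_{ij}|$ be the $\ell_1$-norm of coherence. For a two-qubit state $\mu$ let $E(\mu)=\max\{0,\lambda_1-\lambda_2-\lambda_3-\lambda_4\}$ be the concurrence, where $\lambda_1\ge\lambda_2\ge\lambda_3\ge\lambda_4$ are the square roots of the eigenvalues, with multiplicity, of $\mu\tilde\mu$, with $\tilde\mu=(\sigma_y\otimes\sigma_y)\mu^*(\sigma_y\otimes\sigma_y)$ and $\mu^*$ the entrywise complex conjugate. (1) For every single-qubit state $\rho$, every incoherent single-qubit state $\sigma_i$ and every incoherent operation $\Lambda_i$ on two qubits, $$E(\Lambda_i[\rho\otimes\sigma_i])\le C(\rho).$$ (2) Equality is attained by the CNOT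 gate $U|a\rangle\otimes|b\rangle=|a\rangle\otimes|a+b \bmod 2\rangle$ (control: first qubit; target: ancilla): the map $X\mapsto UXU^\dagger$ is an incoherent operation, and for every single-qubit state $\rho$ and each ancilla in a basis state, $\sigma_i=|j\rangle\langle j|$ with $j\in\{0,1\}$ (which is incoherent), $$E\big(U(\rho\otimes|j\rangle\langle j|)U^\dagger\big)=C(\rho).$$ -/

import Mathlib

open scoped Matrix Kronecker ComplexOrder

noncomputable section

namespace QubitCoherence

/-- Operators on a single qubit, written in the computational basis `|0⟩, |1⟩`. -/
abbrev QubitOp : Type := Matrix (Fin 2) (Fin 2) ℂ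

/-- Operators on two qubits, written in the product basis `|i⟩ ⊗ |j⟩`. -/
abbrev TwoQubitOp : Type := Matrix (Fin 2 × Fin 2) (Fin 2 × Fin 2) ℂ

/-- Density matrices: positive semidefinite matrices of trace one. -/
def IsState {n : Type*} [Fintype n] (ρ : Matrix n n ℂ) : Prop :=
  ρ.PosSemidef ∧ ρ.trace = 1

/-- Incoherent states: density matrices that are diagonal in the reference basis. -/
def IsIncoherentState {n : Type*} [Fintype n] (ρ : Matrix n n ℂ) : Prop :=
  IsState ρ ∧ ρ.IsDiag

/-- A map on operators is an incoherent operation if it has a (finite) Kraus representation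
`X ↦ ∑ k, K k * X * (K k)ᴴ` with `∑ k, (K k)ᴴ * K k = 1`, in which each single Kraus operator
sends every incoherent state to an incoherent state, up to normalization. -/
def IsIncoherentOperation {n : Type*} [Fintype n] [DecidableEq n]
    (Φ : Matrix n n ℂ → Matrix n n ℂ) : Prop :=
  ∃ (N : ℕ) (K : Fin N → Matrix n n ℂ),
    ∑ k, (K k)ᴴ * K k = 1 ∧
    (∀ k δ, IsIncoherentState δ → (K k * δ * (K k)ᴴ).IsDiag) ∧
    ∀ X, Φ X = ∑ k, K k * X * (K k)ᴴ

/-- The `ℓ₁`-norm of coherence: the sum of the absolute values of the off-diagonal entries. -/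
def l1Coherence {n : Type*} [Fintype n] [DecidableEq n] (ρ : Matrix n n ℂ) : ℝ :=
  ∑ i, ∑ j with i ≠ j, ‖ρ i j‖

/-- The Pauli matrix `σ_y`. -/
def pauliY : QubitOp := !![0, -Complex.I; Complex.I, 0]

/-- The spin-flipped matrix `(σ_y ⊗ σ_y) ρ* (σ_y ⊗ σ_y)`, where `ρ*` is the entrywise complex
conjugate of `ρ` in the computational basis. -/
def spinFlip (ρ : TwoQubitOp) : TwoQubitOp :=
  (pauliY ⊗ₖ pauliY) * ρ.map star * (pauliY ⊗ₖ pauliY)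

/-- The square roots of the eigenvalues of `ρ * spinFlip ρ`, listed with (algebraic) multiplicity
in decreasing order. For a density matrix `ρ` these eigenvalues are real and nonnegative. -/
def concurrenceSpectrum (ρ : TwoQubitOp) : List ℝ :=
  ((ρ * spinFlip ρ).charpoly.roots.map fun z => √z.re).sort (· ≥ ·)

theorem length_concurrenceSpectrum (ρ : TwoQubitOp) : (concurrenceSpectrum ρ).length = 4 := by
  rw [concurrenceSpectrum, Multiset.length_sort, Multiset.card_map,
    IsAlgClosed.card_roots_eq_natDegree, Matrix.charpoly_natDegree_eq_dim]
  simp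

/-- The `i`-th largest square root of an eigenvalue of `ρ * spinFlip ρ`, counted from `0`. -/
def concurrenceEigenvalue (ρ : TwoQubitOp) (i : Fin 4) : ℝ :=
  (concurrenceSpectrum ρ).get (i.cast (length_concurrenceSpectrum ρ).symm)

/-- The concurrence `max {0, λ₁ - λ₂ - λ₃ - λ₄}` of a two-qubit state. -/
def concurrence (ρ : TwoQubitOp) : ℝ :=
  max 0 (concurrenceEigenvalue ρ 0 - concurrenceEigenvalue ρ 1
    - concurrenceEigenvalue ρ 2 - concurrenceEigenvalue ρ 3)

/-- The CNOT gate `|a⟩ ⊗ |b⟩ ↦ |a⟩ ⊗ |a + b mod 2⟩`: the first qubit is the control, the second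
qubit is the target. -/
def cnot : TwoQubitOp :=
  Matrix.of fun x y => if x.1 = y.1 ∧ x.2 = y.1 + y.2 then 1 else 0

/-- The action `X ↦ U X U†` of the CNOT gate on operators. -/
def cnotOperation (X : TwoQubitOp) : TwoQubitOp := cnot * X * cnotᴴ

/-- The projector `|j⟩⟨j|` on a computational basis state of a qubit. -/
def basisState (j : Fin 2) : QubitOp := Matrix.single j j 1

end QubitCoherence

end

namespace QubitCoherence

open Matrix Polynomial

/-! Upper bound. Let the columns of `V` be unnormalized pure states with `V * Vᴴ` the output state,
and put `T = Vᵀ (σ_y ⊗ σ_y) V`. Up to zeros, the `λ`'s are the singular values of the symmetric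
matrix `T`, and the `|T k k|` are the concurrences of the columns;
`sqrt_eigenvalues_sub_le_sum_norm_diag` compares the two.

Split `ρ` into pure terms with amplitudes `(p, q)` whose products `|p||q|` add up to `|ρ 0 1|`, and
the ancilla into basis states. Columns of an incoherent Kraus operator have at most one nonzero
entry, so each output vector superposes two multiples of basis vectors, and its concurrence is at
most `|p||q|` times the squared norms of the two columns. Summed over the Kraus operators these
norms give 2, hence the bound `2 |ρ 0 1| = C(ρ)`.

Equality. For CNOT the spectrum reduces to that of a 2 × 2 matrix, with `λ = √(ad) ± |b|`, where `a,
d` are the populations and `b` the coherence of `ρ`; the difference is `2 |b|`. -/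

/-- The sum of the entries of the concurrence spectrum. -/
theorem sum_concurrenceSpectrum (ρ : TwoQubitOp) :
    (concurrenceSpectrum ρ).sum =
      ((ρ * spinFlip ρ).charpoly.roots.map fun z => √z.re).sum := by
  rw [concurrenceSpectrum, ← Multiset.sum_coe, Multiset.sort_eq]

theorem concurrenceEigenvalue_sub_eq (ρ : TwoQubitOp) :
    concurrenceEigenvalue ρ 0 - concurrenceEigenvalue ρ 1
      - concurrenceEigenvalue ρ 2 - concurrenceEigenvalue ρ 3 =
    2 * concurrenceEigenvalue ρ 0 - (concurrenceSpectrum ρ).sum := by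
  have h : (concurrenceSpectrum ρ).sum = ∑ i : Fin 4, concurrenceEigenvalue ρ i := by
    rw [← List.sum_ofFn]
    congr 1
    refine List.ext_get (by simp [length_concurrenceSpectrum]) fun i h₁ h₂ => ?_
    rw [List.get_ofFn]
    rfl
  rw [h, Fin.sum_univ_four]
  ring

/-- An upper bound for the concurrence in terms of the eigenvalues, without sorting them. -/
theorem concurrence_le {ρ : TwoQubitOp} {c : ℝ} (hc : 0 ≤ c)
    (h : ∀ z ∈ (ρ * spinFlip ρ).charpoly.roots,
      2 * √z.re - ((ρ * spinFlip ρ).charpoly.roots.map fun z => √z.re).sum ≤ c) :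
    concurrence ρ ≤ c := by
  refine max_le hc ?_
  rw [concurrenceEigenvalue_sub_eq, sum_concurrenceSpectrum]
  have hmem : concurrenceEigenvalue ρ 0 ∈ concurrenceSpectrum ρ := List.get_mem _ _
  rw [concurrenceSpectrum, Multiset.mem_sort, Multiset.mem_map] at hmem
  obtain ⟨z, hz, hz'⟩ := hmem
  rw [← hz']
  exact h z hz

/-- Each eigenvalue gives a lower bound for the concurrence. -/
theorem le_concurrence {ρ : TwoQubitOp} {z : ℂ} (hz : z ∈ (ρ * spinFlip ρ).charpoly.roots) :
    2 * √z.re - ((ρ * spinFlip ρ).charpoly.roots.map fun z => √z.re).sum ≤ concurrence ρ := by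
  refine le_max_of_le_right ?_
  rw [concurrenceEigenvalue_sub_eq, sum_concurrenceSpectrum]
  have hmem : √z.re ∈ concurrenceSpectrum ρ := by
    rw [concurrenceSpectrum, Multiset.mem_sort, Multiset.mem_map]
    exact ⟨z, hz, rfl⟩
  obtain ⟨i, hi⟩ := List.get_of_mem hmem
  have hle : √z.re ≤ concurrenceEigenvalue ρ 0 := by
    rw [← hi]
    exact (Multiset.pairwise_sort (r := (· ≥ ·)) _).rel_get_of_le (Fin.mk_le_of_le_val (Nat.zero_le _))
  linarith

/-! ### Spectra of `A * B` and `B * A` -/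

/-- Passing from `A * B` to `B * A` does not change the nonzero eigenvalues. -/
theorem roots_charpoly_mul_comm {m n : Type*} [Fintype m] [DecidableEq m] [Fintype n]
    [DecidableEq n] (A : Matrix m n ℂ) (B : Matrix n m ℂ) :
    Multiset.replicate (Fintype.card n) 0 + (A * B).charpoly.roots =
      Multiset.replicate (Fintype.card m) 0 + (B * A).charpoly.roots := by
  have h := congrArg roots (charpoly_mul_comm' A B)
  rw [roots_mul (mul_ne_zero (by simp) (charpoly_monic _).ne_zero),
    roots_mul (mul_ne_zero (by simp) (charpoly_monic _).ne_zero)] at h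
  simpa [Multiset.nsmul_singleton] using h

/-- The padding zeros do not contribute, since `√0 = 0`. -/
theorem sum_sqrt_roots_charpoly_mul_comm {m n : Type*} [Fintype m] [DecidableEq m] [Fintype n]
    [DecidableEq n] (A : Matrix m n ℂ) (B : Matrix n m ℂ) :
    ((A * B).charpoly.roots.map fun z => √z.re).sum =
      ((B * A).charpoly.roots.map fun z => √z.re).sum := by
  simpa using congrArg (fun s => (Multiset.map (fun z : ℂ => √z.re) s).sum)
    (roots_charpoly_mul_comm A B)

theorem mem_roots_charpoly_mul_comm {m n : Type*} [Fintype m] [DecidableEq m] [Fintype n]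
    [DecidableEq n] (A : Matrix m n ℂ) (B : Matrix n m ℂ) {z : ℂ} (hz : z ≠ 0) :
    z ∈ (A * B).charpoly.roots ↔ z ∈ (B * A).charpoly.roots := by
  have h : z ∈ Multiset.replicate (Fintype.card n) 0 + (A * B).charpoly.roots ↔
      z ∈ Multiset.replicate (Fintype.card m) 0 + (B * A).charpoly.roots := by
    rw [roots_charpoly_mul_comm]
  simpa [Multiset.mem_add, Multiset.mem_replicate, hz] using h

/-! ### Singular values and diagonal of a symmetric matrix -/

/-- For a complex symmetric matrix `T`, a singular value minus all the others is bounded by the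
sum of the absolute values of the diagonal entries. -/
theorem sqrt_eigenvalues_sub_le_sum_norm_diag {n : Type*} [Fintype n] [DecidableEq n]
    {T : Matrix n n ℂ} (hT : T.IsSymm) (i : n) :
    let h := isHermitian_conjTranspose_mul_self T
    2 * √(h.eigenvalues i) - ∑ j, √(h.eigenvalues j) ≤ ∑ k, ‖T k k‖ := by
  intro h
  set ev := h.eigenvalues with hev
  have hnn : ∀ j, 0 ≤ ev j := eigenvalues_conjTranspose_mul_self_nonneg T
  have hsum : ∑ j, √(ev j) = √(ev i) + ∑ j ∈ Finset.univ.erase i, √(ev j) :=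
    (Finset.add_sum_erase _ _ (Finset.mem_univ i)).symm
  -- A repeated eigenvalue makes the left side nonpositive, as its second copy cancels the first.
  -- Otherwise the eigenspace of `ev i` is a line.
  by_cases hdeg : ∃ j, j ≠ i ∧ ev j = ev i
  · obtain ⟨j, hji, hj⟩ := hdeg
    have h₁ : √(ev j) ≤ ∑ j ∈ Finset.univ.erase i, √(ev j) :=
      Finset.single_le_sum (f := fun j => √(ev j)) (fun _ _ => Real.sqrt_nonneg _)
        (Finset.mem_erase.2 ⟨hji, Finset.mem_univ j⟩)
    have h₂ : 0 ≤ ∑ k, ‖T k k‖ := Finset.sum_nonneg fun _ _ => norm_nonneg _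
    rw [hj] at h₁
    linarith
  push Not at hdeg
  set U : Matrix n n ℂ := (h.eigenvectorUnitary : Matrix n n ℂ) with hU
  set D : Matrix n n ℂ := diagonal fun j => (ev j : ℂ) with hD
  have hUU : Uᴴ * U = 1 := Unitary.coe_star_mul_self h.eigenvectorUnitary
  have hUU' : U * Uᴴ = 1 := Unitary.coe_mul_star_self h.eigenvectorUnitary
  have hspec : Tᴴ * T = U * D * Uᴴ := by
    simpa [Unitary.conjStarAlgAut_apply] using! h.spectral_theorem
  have hHU : Tᴴ * T * U = U * D := by rw [hspec, Matrix.mul_assoc, hUU, Matrix.mul_one]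
  set W : Matrix n n ℂ := T * U with hW
  have hTW : T = W * Uᴴ := by rw [hW, Matrix.mul_assoc, hUU', Matrix.mul_one]
  have hWW : Wᴴ * W = D := by
    rw [hW, conjTranspose_mul, Matrix.mul_assoc, ← Matrix.mul_assoc Tᴴ, hHU, ← Matrix.mul_assoc,
      hUU, Matrix.one_mul]
  have hWcol : ∀ j, ∑ k, ‖W k j‖ ^ 2 = ev j := fun j => by
    have := congrFun (congrFun hWW j) j
    simp only [mul_apply, conjTranspose_apply, hD, diagonal_apply_eq, RCLike.star_def,
      Complex.conj_mul'] at this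
    exact_mod_cast this
  have hUcol : ∀ j, ∑ k, ‖U k j‖ ^ 2 = 1 := fun j => by
    have := congrFun (congrFun hUU j) j
    simp only [mul_apply, conjTranspose_apply, one_apply_eq, RCLike.star_def,
      Complex.conj_mul'] at this
    exact_mod_cast this
  have hCS : ∀ j, ∑ k, ‖W k j‖ * ‖U k j‖ ≤ √(ev j) := fun j => by
    simpa [hWcol, hUcol] using
      Real.sum_mul_le_sqrt_mul_sqrt Finset.univ (fun k => ‖W k j‖) (fun k => ‖U k j‖)
  -- The entrywise conjugate of column `i` of `W` is again an eigenvector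
  have hTc : T.map star = Tᴴ := by rw [conjTranspose, hT.eq]
  have hTc' : Tᴴ.map star = T := by rw [← hTc]; ext; simp
  set Wc : Matrix n n ℂ := W.map star with hWc
  have hWcU : Wc = Tᴴ * U.map star := by
    rw [← hTc, hWc, hW]; ext; simp [mul_apply]
  -- Symmetry of `T` turns the conjugate of `Tᴴ * T` into `T * Tᴴ`; `D` is real, so conjugation
  -- fixes it.
  have hcomm : Tᴴ * T * Wc = Wc * D := by
    have h₁ : T * (Tᴴ * U.map star) = U.map star * D := by
      have h₂ := congrArg (fun M : Matrix n n ℂ => M.map star) hHU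
      have h₃ : (Tᴴ * T * U).map star = Tᴴ.map star * (T.map star * U.map star) := by
        ext; simp [mul_apply, Finset.mul_sum, mul_assoc]
      have h₄ : (U * D).map star = U.map star * D := by
        ext; simp [hD, mul_diagonal]
      rw [hTc', hTc] at h₃
      rw [← h₃, ← h₄]
      exact h₂
    rw [hWcU, Matrix.mul_assoc, h₁, Matrix.mul_assoc]
  set M : Matrix n n ℂ := Uᴴ * Wc with hM
  have hUM : Wc = U * M := by rw [hM, ← Matrix.mul_assoc, hUU', Matrix.one_mul]
  have hDM : D * M = M * D := by
    rw [hM, Matrix.mul_assoc, ← hcomm, hspec]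
    simp only [← Matrix.mul_assoc, hUU, Matrix.one_mul]
  -- Simplicity of `ev i` forces column `i` of `Wc` to be a multiple of column `i` of `U`. Thus
  -- `hCS` is an equality at `j = i`.
  have hM0 : ∀ j, j ≠ i → M j i = 0 := fun j hj => by
    have := congrFun (congrFun hDM j) i
    simp only [hD, diagonal_mul, mul_diagonal] at this
    have h₁ : ((ev j : ℂ) - ev i) * M j i = 0 := by linear_combination this
    refine (mul_eq_zero.1 h₁).resolve_left (sub_ne_zero.2 ?_)
    exact_mod_cast hdeg j hj
  have hWi : ∀ k, ‖W k i‖ = ‖M i i‖ * ‖U k i‖ := fun k => by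
    have h₁ : Wc k i = U k i * M i i := by
      rw [hUM, mul_apply]
      exact Finset.sum_eq_single i (fun j _ hj => by rw [hM0 j hj, mul_zero]) (by simp)
    have h₂ : ‖Wc k i‖ = ‖W k i‖ := by simp [hWc]
    rw [← h₂, h₁, norm_mul, mul_comm]
  have hMi : ‖M i i‖ = √(ev i) := by
    rw [← hWcol i]
    simp only [hWi, mul_pow, ← Finset.mul_sum, hUcol, mul_one, Real.sqrt_sq (norm_nonneg _)]
  have hi : ∑ k, ‖W k i‖ * ‖U k i‖ = √(ev i) := by
    simp only [hWi, hMi, mul_assoc, ← sq, ← Finset.mul_sum, hUcol, mul_one]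
  -- Reverse triangle inequality in `T k k = ∑ j, W k j * star (U k j)`, isolating the term `j = i`.
  have hdiag : ∀ k, ‖W k i‖ * ‖U k i‖ - ∑ j ∈ Finset.univ.erase i, ‖W k j‖ * ‖U k j‖ ≤
      ‖T k k‖ := fun k => by
    have h₁ : T k k = W k i * star (U k i) +
        ∑ j ∈ Finset.univ.erase i, W k j * star (U k j) := by
      rw [Finset.add_sum_erase _ (fun j => W k j * star (U k j)) (Finset.mem_univ i)]
      conv_lhs => rw [hTW, mul_apply]
      simp
    have h₂ : ‖∑ j ∈ Finset.univ.erase i, W k j * star (U k j)‖ ≤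
        ∑ j ∈ Finset.univ.erase i, ‖W k j‖ * ‖U k j‖ :=
      (norm_sum_le _ _).trans_eq (by simp)
    have h₃ : ‖W k i * star (U k i)‖ ≤ ‖T k k‖ +
        ‖∑ j ∈ Finset.univ.erase i, W k j * star (U k j)‖ := by
      rw [← sub_eq_iff_eq_add] at h₁
      rw [← h₁]
      exact norm_sub_le _ _
    rw [norm_mul, norm_star] at h₃
    linarith
  calc 2 * √(ev i) - ∑ j, √(ev j)
      = √(ev i) - ∑ j ∈ Finset.univ.erase i, √(ev j) := by rw [hsum]; ring
    _ ≤ ∑ k, ‖W k i‖ * ‖U k i‖ -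
        ∑ j ∈ Finset.univ.erase i, ∑ k, ‖W k j‖ * ‖U k j‖ := by
      rw [hi]
      exact sub_le_sub_left (Finset.sum_le_sum fun j _ => hCS j) _
    _ = ∑ k, (‖W k i‖ * ‖U k i‖ - ∑ j ∈ Finset.univ.erase i, ‖W k j‖ * ‖U k j‖) := by
      rw [Finset.sum_sub_distrib, Finset.sum_comm]
    _ ≤ ∑ k, ‖T k k‖ := Finset.sum_le_sum fun k _ => hdiag k

/-! ### Concurrence of a mixture -/

theorem pauliY_kronecker_transpose : (pauliY ⊗ₖ pauliY)ᵀ = pauliY ⊗ₖ pauliY := by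
  ext ⟨a, b⟩ ⟨c, d⟩
  fin_cases a <;> fin_cases b <;> fin_cases c <;> fin_cases d <;> simp [pauliY]

theorem pauliY_kronecker_map_star : (pauliY ⊗ₖ pauliY).map star = pauliY ⊗ₖ pauliY := by
  ext ⟨a, b⟩ ⟨c, d⟩
  fin_cases a <;> fin_cases b <;> fin_cases c <;> fin_cases d <;> simp [pauliY]

/-- The concurrence of a mixture is at most the average of the concurrences of the (unnormalized)
pure states in it, which are the columns of `V`. -/
theorem concurrence_mul_conjTranspose_le {n : Type*} [Fintype n] [DecidableEq n]
    (V : Matrix (Fin 2 × Fin 2) n ℂ) :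
    concurrence (V * Vᴴ) ≤ ∑ k, ‖(Vᵀ * (pauliY ⊗ₖ pauliY) * V) k k‖ := by
  set Y := pauliY ⊗ₖ pauliY with hY
  set T := Vᵀ * Y * V with hT
  have hsymm : T.IsSymm := by
    rw [Matrix.IsSymm, hT, transpose_mul, transpose_mul, transpose_transpose,
      pauliY_kronecker_transpose, Matrix.mul_assoc]
  have hYH : Yᴴ = Y := by
    rw [conjTranspose, pauliY_kronecker_transpose, pauliY_kronecker_map_star]
  have hAB : V * Vᴴ * spinFlip (V * Vᴴ) = V * (Vᴴ * Y * V.map star * Vᵀ * Y) := by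
    have : (V * Vᴴ).map star = V.map star * Vᵀ := by
      ext; simp [mul_apply]
    rw [spinFlip, this]
    simp only [Matrix.mul_assoc, hY]
  have hBA : Vᴴ * Y * V.map star * Vᵀ * Y * V = Tᴴ * T := by
    have : (Vᵀ)ᴴ = V.map star := by ext; simp
    rw [hT, conjTranspose_mul, conjTranspose_mul, hYH, this]
    simp only [Matrix.mul_assoc]
  have hroots := (isHermitian_conjTranspose_mul_self T).roots_charpoly_eq_eigenvalues
  have hnn : 0 ≤ ∑ k, ‖T k k‖ := Finset.sum_nonneg fun _ _ => norm_nonneg _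
  have hS : ((V * Vᴴ * spinFlip (V * Vᴴ)).charpoly.roots.map fun z => √z.re).sum =
      ∑ j, √((isHermitian_conjTranspose_mul_self T).eigenvalues j) := by
    rw [hAB, sum_sqrt_roots_charpoly_mul_comm, hBA, hroots]
    simp [Multiset.map_map]
  refine concurrence_le hnn fun z hz => ?_
  rw [hS]
  -- A zero root need not be an eigenvalue of `Tᴴ * T`, but for it the bound is trivial.
  by_cases hz0 : z = 0
  · have : 0 ≤ ∑ j, √((isHermitian_conjTranspose_mul_self T).eigenvalues j) :=
      Finset.sum_nonneg fun _ _ => Real.sqrt_nonneg _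
    simp only [hz0, Complex.zero_re, Real.sqrt_zero]
    linarith
  · rw [hAB, mem_roots_charpoly_mul_comm _ _ hz0, hBA, hroots] at hz
    obtain ⟨i, -, rfl⟩ := Multiset.mem_map.1 hz
    simpa using sqrt_eigenvalues_sub_le_sum_norm_diag hsymm i

/-! ### Incoherent Kraus operators and decompositions of states -/

theorem isIncoherentState_single {n : Type*} [Fintype n] [DecidableEq n] (x : n) :
    IsIncoherentState (single x x (1 : ℂ)) := by
  refine ⟨⟨?_, by simp⟩, fun a b hab => ?_⟩
  · rw [← diagonal_single]
    exact PosSemidef.diagonal (Pi.single_nonneg.2 zero_le_one)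
  · change single x x (1 : ℂ) a b = 0
    rw [single_apply, if_neg]
    rintro ⟨rfl, rfl⟩
    exact hab rfl

/-- A Kraus operator that preserves incoherence has at most one nonzero entry in each column. -/
theorem mul_eq_zero_of_preserves_incoherent {n : Type*} [Fintype n] [DecidableEq n]
    {K : Matrix n n ℂ} (hK : ∀ δ, IsIncoherentState δ → (K * δ * Kᴴ).IsDiag) (x : n) {a b : n}
    (hab : a ≠ b) : K a x * K b x = 0 := by
  have h : (K * single x x (1 : ℂ) * Kᴴ) a b = 0 := hK _ (isIncoherentState_single x) hab
  rw [mul_apply, Finset.sum_eq_single x (fun y _ hy => by simp [mul_single_apply_of_ne, hy])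
    (by simp)] at h
  simpa using h

theorem l1Coherence_eq {ρ : QubitOp} (hρ : ρ.IsHermitian) : l1Coherence ρ = 2 * ‖ρ 0 1‖ := by
  have h : ρ 1 0 = star (ρ 0 1) := (hρ.apply 1 0).symm
  have h₁ : l1Coherence ρ = ‖ρ 0 1‖ + ‖ρ 1 0‖ := by
    simp [l1Coherence, Finset.sum_filter, Fin.sum_univ_two]
  rw [h₁, h, norm_star, two_mul]

/-- The data of a single-qubit state: two populations and one coherence. -/
theorem exists_entries {ρ : QubitOp} (hρ : ρ.PosSemidef) :
    ∃ a d : ℝ, 0 ≤ a ∧ 0 ≤ d ∧ ‖ρ 0 1‖ ^ 2 ≤ a * d ∧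
      ρ = !![(a : ℂ), ρ 0 1; star (ρ 0 1), (d : ℂ)] := by
  obtain ⟨a, ha, ha'⟩ := RCLike.nonneg_iff_exists_ofReal.1 (hρ.diag_nonneg (i := 0))
  obtain ⟨d, hd, hd'⟩ := RCLike.nonneg_iff_exists_ofReal.1 (hρ.diag_nonneg (i := 1))
  have h : ρ 1 0 = star (ρ 0 1) := (hρ.isHermitian.apply 1 0).symm
  refine ⟨a, d, ha, hd, ?_, ?_⟩
  · have hdet := hρ.det_nonneg
    rw [det_fin_two, ← ha', ← hd', h, RCLike.star_def, Complex.mul_conj'] at hdet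
    have : ((0 : ℝ) : ℂ) ≤ ((a * d - ‖ρ 0 1‖ ^ 2 : ℝ) : ℂ) := by
      push_cast
      simpa using hdet
    linarith [Complex.real_le_real.1 this]
  · rw [← h]
    ext i j
    fin_cases i <;> fin_cases j <;> simp [← ha', ← hd']

/-- A positive semidefinite single-qubit operator is a mixture of pure ones whose coherences add
up to that of the mixture. -/
theorem exists_coherence_optimal_decomposition {ρ : QubitOp} (hρ : ρ.PosSemidef) :
    ∃ ψ : QubitOp, ρ = ψ * ψᴴ ∧ ∑ i, ‖ψ 0 i‖ * ‖ψ 1 i‖ = ‖ρ 0 1‖ := by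
  obtain ⟨a, d, ha, hd, hb, hρ'⟩ := exists_entries hρ
  set b := ρ 0 1 with hb'
  rcases ha.eq_or_lt with rfl | ha
  · have hb0 : b = 0 := by
      rw [zero_mul] at hb
      exact norm_eq_zero.1 (pow_eq_zero_iff two_ne_zero |>.1 (le_antisymm hb (sq_nonneg _)))
    refine ⟨!![0, 0; 0, (√d : ℂ)], ?_, by simp [hb0]⟩
    rw [hρ', hb0]
    have : (√d : ℂ) * √d = d := by exact_mod_cast Real.mul_self_sqrt hd
    ext i j
    fin_cases i <;> fin_cases j <;> simp [mul_apply, Fin.sum_univ_two, this]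
  · have hs : (√a : ℂ) * √a = a := by exact_mod_cast Real.mul_self_sqrt ha.le
    have hs0 : √a ≠ 0 := (Real.sqrt_pos.2 ha).ne'
    have hs0' : (√a : ℂ) ≠ 0 := by exact_mod_cast hs0
    have hc : 0 ≤ d - ‖b‖ ^ 2 / a := by
      rw [sub_nonneg, div_le_iff₀ ha]
      linarith
    set c := √(d - ‖b‖ ^ 2 / a) with hc'
    have hcc : (c : ℂ) * c = d - ‖b‖ ^ 2 / a := by exact_mod_cast Real.mul_self_sqrt hc
    -- Cholesky factor: its second column has no `|0⟩` amplitude, so the first one carries the whole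
    -- coherence.
    refine ⟨!![(√a : ℂ), 0; star b / √a, (c : ℂ)], ?_, ?_⟩
    · rw [hρ']
      have h₁ : (starRingEnd ℂ) b / √a * (b / √a) = ‖b‖ ^ 2 / a := by
        rw [div_mul_div_comm, hs, Complex.conj_mul']
      ext i j
      fin_cases i <;> fin_cases j <;> simp [mul_apply, Fin.sum_univ_two, hs, hcc, h₁, hs0',
        mul_div_cancel₀]
    · simp [abs_of_nonneg, Real.sqrt_nonneg, mul_div_cancel₀, hs0]

theorem exists_diagonal_sq {n : Type*} [Fintype n] [DecidableEq n] {σ : Matrix n n ℂ}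
    (hσ : IsIncoherentState σ) :
    ∃ s : n → ℝ, ∑ j, s j ^ 2 = 1 ∧
      σ = diagonal (fun j => (s j : ℂ)) * (diagonal fun j => (s j : ℂ))ᴴ := by
  have h : ∀ j, ∃ t : ℝ, ((t ^ 2 : ℝ) : ℂ) = σ j j := fun j => by
    obtain ⟨t, ht, ht'⟩ := RCLike.nonneg_iff_exists_ofReal.1 (hσ.1.1.diag_nonneg (i := j))
    exact ⟨√t, by rw [Real.sq_sqrt ht]; exact ht'⟩
  choose s hs using h
  refine ⟨s, ?_, ?_⟩
  · have := hσ.1.2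
    simp only [trace, diag_apply, ← hs] at this
    exact_mod_cast this
  · rw [← hσ.2.diagonal_diag, diagonal_conjTranspose, diagonal_mul_diagonal]
    congr 1
    ext j
    simp [← hs, sq]

/-! ### The upper bound -/

/-- The concurrence of an unnormalized pure state. -/
theorem norm_transpose_mul_pauliY_mul_apply {n : Type*} [Fintype n]
    (V : Matrix (Fin 2 × Fin 2) n ℂ) (k : n) :
    ‖(Vᵀ * (pauliY ⊗ₖ pauliY) * V) k k‖ =
      2 * ‖V (0, 0) k * V (1, 1) k - V (0, 1) k * V (1, 0) k‖ := by
  have : (Vᵀ * (pauliY ⊗ₖ pauliY) * V) k k =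
      -2 * (V (0, 0) k * V (1, 1) k - V (0, 1) k * V (1, 0) k) := by
    simp [mul_apply, Fintype.sum_prod_type, Fin.sum_univ_two, pauliY]
    ring
  rw [this, norm_mul]
  simp

/-- The concurrence generated by an incoherent Kraus operator with columns `x` and `y` from a
pure product state with amplitudes `p` and `q`. -/
theorem norm_concurrence_superposition_le {x y : Fin 2 × Fin 2 → ℂ}
    (hx : ∀ a b, a ≠ b → x a * x b = 0) (hy : ∀ a b, a ≠ b → y a * y b = 0) (p q : ℂ) :
    2 * ‖(p * x (0, 0) + q * y (0, 0)) * (p * x (1, 1) + q * y (1, 1)) -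
      (p * x (0, 1) + q * y (0, 1)) * (p * x (1, 0) + q * y (1, 0))‖ ≤
      ‖p‖ * ‖q‖ * (∑ a, ‖x a‖ ^ 2 + ∑ a, ‖y a‖ ^ 2) := by
  have h : (p * x (0, 0) + q * y (0, 0)) * (p * x (1, 1) + q * y (1, 1)) -
      (p * x (0, 1) + q * y (0, 1)) * (p * x (1, 0) + q * y (1, 0)) =
      p * q * ((x (0, 0) * y (1, 1) + x (1, 1) * y (0, 0)) -
        (x (0, 1) * y (1, 0) + x (1, 0) * y (0, 1))) := by
    -- The `p ^ 2` and `q ^ 2` terms are products of distinct entries of one column, so they vanish.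
    linear_combination p ^ 2 * hx (0, 0) (1, 1) (by decide) - p ^ 2 * hx (0, 1) (1, 0) (by decide)
      + q ^ 2 * hy (0, 0) (1, 1) (by decide) - q ^ 2 * hy (0, 1) (1, 0) (by decide)
  have hm : ∀ a b, 2 * ‖x a * y b‖ ≤ ‖x a‖ ^ 2 + ‖y b‖ ^ 2 := fun a b => by
    rw [norm_mul, ← mul_assoc]
    exact two_mul_le_add_sq _ _
  have h₁ := norm_sub_le (x (0, 0) * y (1, 1) + x (1, 1) * y (0, 0))
    (x (0, 1) * y (1, 0) + x (1, 0) * y (0, 1))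
  have h₂ := norm_add_le (x (0, 0) * y (1, 1)) (x (1, 1) * y (0, 0))
  have h₃ := norm_add_le (x (0, 1) * y (1, 0)) (x (1, 0) * y (0, 1))
  rw [h, norm_mul, norm_mul, mul_left_comm]
  refine mul_le_mul_of_nonneg_left ?_ (by positivity)
  simp only [Fintype.sum_prod_type, Fin.sum_univ_two]
  linarith [hm (0, 0) (1, 1), hm (1, 1) (0, 0), hm (0, 1) (1, 0), hm (1, 0) (0, 1)]

theorem sum_norm_sq_kraus_column {n : Type*} [Fintype n] [DecidableEq n] {N : ℕ}
    {K : Fin N → Matrix n n ℂ} (hK : ∑ k, (K k)ᴴ * K k = 1) (x : n) :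
    ∑ k, ∑ a, ‖K k a x‖ ^ 2 = 1 := by
  have h := congrFun (congrFun hK x) x
  simp only [Matrix.sum_apply, mul_apply, conjTranspose_apply, one_apply_eq, RCLike.star_def,
    Complex.conj_mul'] at h
  exact_mod_cast h

/-- The concurrence created by an incoherent operation from a single-qubit state and an incoherent
ancilla is bounded by the coherence of the state. -/
theorem concurrence_incoherentOperation_le {ρ σ : QubitOp} {Φ : TwoQubitOp → TwoQubitOp}
    (hρ : IsState ρ) (hσ : IsIncoherentState σ) (hΦ : IsIncoherentOperation Φ) :
    concurrence (Φ (ρ ⊗ₖ σ)) ≤ l1Coherence ρ := by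
  obtain ⟨N, K, hK, hinc, hΦ⟩ := hΦ
  obtain ⟨ψ, hψ, hψ'⟩ := exists_coherence_optimal_decomposition hρ.1
  obtain ⟨s, hs, hs'⟩ := exists_diagonal_sq hσ
  set S : QubitOp := diagonal fun j => (s j : ℂ) with hS
  -- A column of `V` is indexed by a Kraus operator, a pure component of `ρ` and a basis state of
  -- the ancilla.
  set V : Matrix (Fin 2 × Fin 2) (Fin N × Fin 2 × Fin 2) ℂ :=
    of fun a p => (K p.1 * (ψ ⊗ₖ S)) a p.2 with hV
  have hΦV : Φ (ρ ⊗ₖ σ) = V * Vᴴ := by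
    have h₁ : ρ ⊗ₖ σ = (ψ ⊗ₖ S) * (ψ ⊗ₖ S)ᴴ := by
      rw [conjTranspose_kronecker, ← mul_kronecker_mul, ← hψ, ← hs']
    have h₂ : ∀ k, K k * (ρ ⊗ₖ σ) * (K k)ᴴ =
        (K k * (ψ ⊗ₖ S)) * (K k * (ψ ⊗ₖ S))ᴴ := fun k => by
      rw [h₁, conjTranspose_mul]
      simp only [Matrix.mul_assoc]
    rw [hΦ]
    simp only [h₂]
    ext a b
    rw [mul_apply, Matrix.sum_apply, Fintype.sum_prod_type]
    simp only [mul_apply (M := K _ * (ψ ⊗ₖ S)), hV, conjTranspose_apply, of_apply]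
  have hVapp : ∀ a k i j, V a (k, i, j) =
      (s j * ψ 0 i) * K k a (0, j) + (s j * ψ 1 i) * K k a (1, j) := fun a k i j => by
    simp only [hV, of_apply, mul_apply, Fintype.sum_prod_type, Fin.sum_univ_two, kronecker_apply,
      hS]
    fin_cases j <;> simp <;> ring
  rw [hΦV, l1Coherence_eq hρ.1.isHermitian, ← hψ']
  refine (concurrence_mul_conjTranspose_le V).trans ?_
  calc ∑ p, ‖(Vᵀ * (pauliY ⊗ₖ pauliY) * V) p p‖
      ≤ ∑ p : Fin N × Fin 2 × Fin 2, ‖(s p.2.2 * ψ 0 p.2.1 : ℂ)‖ * ‖(s p.2.2 * ψ 1 p.2.1 : ℂ)‖ *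
          (∑ a, ‖K p.1 a (0, p.2.2)‖ ^ 2 + ∑ a, ‖K p.1 a (1, p.2.2)‖ ^ 2) := by
        refine Finset.sum_le_sum fun ⟨k, i, j⟩ _ => ?_
        rw [norm_transpose_mul_pauliY_mul_apply]
        simp only [hVapp]
        exact norm_concurrence_superposition_le
          (fun a b => mul_eq_zero_of_preserves_incoherent (hinc k) (0, j))
          (fun a b => mul_eq_zero_of_preserves_incoherent (hinc k) (1, j)) _ _
    _ = ∑ q : Fin 2 × Fin 2, ‖(s q.2 * ψ 0 q.1 : ℂ)‖ * ‖(s q.2 * ψ 1 q.1 : ℂ)‖ * 2 := by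
        rw [Fintype.sum_prod_type_right]
        dsimp only
        refine Finset.sum_congr rfl fun q _ => ?_
        rw [← Finset.mul_sum, Finset.sum_add_distrib, sum_norm_sq_kraus_column hK,
          sum_norm_sq_kraus_column hK]
        norm_num
    _ = 2 * (∑ i, ‖ψ 0 i‖ * ‖ψ 1 i‖) * ∑ j, s j ^ 2 := by
        rw [Fintype.sum_prod_type, mul_assoc, Finset.sum_mul, Finset.mul_sum]
        dsimp only
        refine Finset.sum_congr rfl fun i _ => ?_
        rw [Finset.mul_sum, Finset.mul_sum]
        refine Finset.sum_congr rfl fun j _ => ?_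
        simp only [norm_mul, Complex.norm_real, Real.norm_eq_abs]
        rw [← sq_abs (s j)]
        ring
    _ = 2 * ∑ i, ‖ψ 0 i‖ * ‖ψ 1 i‖ := by rw [hs, mul_one]

/-! ### Equality for the CNOT gate -/

theorem cnotOperation_isIncoherentOperation : IsIncoherentOperation cnotOperation := by
  refine ⟨1, fun _ => cnot, ?_, fun _ δ hδ => ?_, fun X => by simp [cnotOperation]⟩
  · ext ⟨a, b⟩ ⟨c, d⟩
    fin_cases a <;> fin_cases b <;> fin_cases c <;> fin_cases d <;>
      simp [cnot, mul_apply, Fintype.sum_prod_type, Fin.sum_univ_two]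
  · rw [← hδ.2.diagonal_diag]
    rintro ⟨a, b⟩ ⟨c, d⟩ h
    revert h
    fin_cases a <;> fin_cases b <;> fin_cases c <;> fin_cases d <;>
      simp [cnot, mul_apply, Fintype.sum_prod_type, Fin.sum_univ_two]

/-- The isometry `|a⟩ ↦ |a⟩ ⊗ |a + j mod 2⟩`. -/
def cnotIsometry (j : Fin 2) : Matrix (Fin 2 × Fin 2) (Fin 2) ℂ :=
  of fun x a => if x.1 = a ∧ x.2 = a + j then 1 else 0

theorem cnotOperation_kronecker_basisState (ρ : QubitOp) (j : Fin 2) :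
    cnotOperation (ρ ⊗ₖ basisState j) = cnotIsometry j * ρ * (cnotIsometry j)ᴴ := by
  ext ⟨a, b⟩ ⟨c, d⟩
  fin_cases j <;> fin_cases a <;> fin_cases b <;> fin_cases c <;> fin_cases d <;>
    simp [cnotOperation, basisState, cnot, cnotIsometry, mul_apply, Fintype.sum_prod_type,
      Fin.sum_univ_two]

/-- `σ_y ⊗ σ_y` swaps the two basis vectors in the range of the isometry with a common sign, which
cancels; what remains is `σ_x ρ* σ_x`. -/
theorem cnotIsometry_spinFlip (ρ : QubitOp) (j : Fin 2) :
    (cnotIsometry j)ᴴ * spinFlip (cnotIsometry j * ρ * (cnotIsometry j)ᴴ) * cnotIsometry j =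
      !![star (ρ 1 1), star (ρ 1 0); star (ρ 0 1), star (ρ 0 0)] := by
  ext a b
  fin_cases j <;> fin_cases a <;> fin_cases b <;>
    simp [spinFlip, pauliY, cnotIsometry, mul_apply, Fintype.sum_prod_type, Fin.sum_univ_two]

theorem l1Coherence_le_concurrence_cnotOperation {ρ : QubitOp} (hρ : IsState ρ) (j : Fin 2) :
    l1Coherence ρ ≤ concurrence (cnotOperation (ρ ⊗ₖ basisState j)) := by
  obtain ⟨a, d, ha, hd, hb, hρ'⟩ := exists_entries hρ.1
  rw [l1Coherence_eq hρ.1.isHermitian, cnotOperation_kronecker_basisState]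
  set b := ρ 0 1 with hb'
  set W := cnotIsometry j with hW
  set μ := W * ρ * Wᴴ with hμ
  have hAB : μ * spinFlip μ = W * (ρ * (Wᴴ * spinFlip μ)) := by
    simp only [hμ, Matrix.mul_assoc]
  have hBA : ρ * (Wᴴ * spinFlip μ) * W = !![(a * d + ‖b‖ ^ 2 : ℂ), 2 * a * b;
      2 * d * star b, (a * d + ‖b‖ ^ 2 : ℂ)] := by
    rw [Matrix.mul_assoc, cnotIsometry_spinFlip, hρ']
    have h₁ := Complex.mul_conj' b
    have h₂ := Complex.conj_mul' b
    ext x y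
    fin_cases x <;> fin_cases y <;> simp [mul_apply, Fin.sum_univ_two, h₁, h₂] <;> ring
  have hroots : (ρ * (Wᴴ * spinFlip μ) * W).charpoly.roots =
      {(((√(a * d) + ‖b‖) ^ 2 : ℝ) : ℂ), (((√(a * d) - ‖b‖) ^ 2 : ℝ) : ℂ)} := by
    have hsq : (√(a * d) : ℂ) ^ 2 = a * d := by exact_mod_cast Real.sq_sqrt (mul_nonneg ha hd)
    have : (ρ * (Wᴴ * spinFlip μ) * W).charpoly =
        (X - C (((√(a * d) + ‖b‖) ^ 2 : ℝ) : ℂ)) * (X - C (((√(a * d) - ‖b‖) ^ 2 : ℝ) : ℂ)) := by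
      have htr : (ρ * (Wᴴ * spinFlip μ) * W).trace =
          (((√(a * d) + ‖b‖) ^ 2 : ℝ) : ℂ) + (((√(a * d) - ‖b‖) ^ 2 : ℝ) : ℂ) := by
        rw [hBA, trace_fin_two]
        simp
        linear_combination -2 * hsq
      have hdet : (ρ * (Wᴴ * spinFlip μ) * W).det =
          (((√(a * d) + ‖b‖) ^ 2 : ℝ) : ℂ) * (((√(a * d) - ‖b‖) ^ 2 : ℝ) : ℂ) := by
        rw [hBA, det_fin_two]
        simp
        linear_combination (-4 * a * d : ℂ) * Complex.mul_conj' b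
          - ((√(a * d) : ℂ) ^ 2 + a * d - 2 * ‖b‖ ^ 2) * hsq
      rw [charpoly_fin_two, htr, hdet, C_add, C_mul]
      ring
    rw [this, roots_mul (mul_ne_zero (X_sub_C_ne_zero _) (X_sub_C_ne_zero _)), roots_X_sub_C,
      roots_X_sub_C]
    rfl
  -- Positivity of `ρ` makes the smaller root `√(ad) - |b|` rather than its negative, so the roots
  -- sum to `2 √(ad)`.
  have hle : ‖b‖ ≤ √(a * d) := Real.le_sqrt_of_sq_le hb
  have hsum : ((μ * spinFlip μ).charpoly.roots.map fun z => √z.re).sum = 2 * √(a * d) := by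
    rw [hAB, sum_sqrt_roots_charpoly_mul_comm, hroots]
    simp only [Multiset.insert_eq_cons, Multiset.map_cons, Multiset.map_singleton,
      Multiset.sum_cons, Multiset.sum_singleton, Complex.ofReal_re]
    rw [Real.sqrt_sq (by positivity), Real.sqrt_sq (sub_nonneg.2 hle)]
    ring
  -- Only nonzero eigenvalues pass to `μ * spinFlip μ`; `b ≠ 0` ensures this for the larger one.
  by_cases hb0 : b = 0
  · rw [hb0, norm_zero, mul_zero]
    exact le_max_left _ _
  · have hpos : 0 < ‖b‖ := norm_pos_iff.2 hb0
    have hmem : (((√(a * d) + ‖b‖) ^ 2 : ℝ) : ℂ) ∈ (μ * spinFlip μ).charpoly.roots := by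
      rw [hAB, mem_roots_charpoly_mul_comm, hroots]
      · simp
      · have : (√(a * d) + ‖b‖) ^ 2 ≠ 0 := by positivity
        exact_mod_cast this
    have h := le_concurrence hmem
    rw [hsum, Complex.ofReal_re, Real.sqrt_sq (by positivity)] at h
    linarith

end QubitCoherence

theorem mainTheorem4 :
    (∀ (ρ σ : QubitCoherence.QubitOp)
        (Φ : QubitCoherence.TwoQubitOp → QubitCoherence.TwoQubitOp),
      QubitCoherence.IsState ρ → QubitCoherence.IsIncoherentState σ →
      QubitCoherence.IsIncoherentOperation Φ →
        QubitCoherence.concurrence (Φ (ρ ⊗ₖ σ)) ≤ QubitCoherence.l1Coherence ρ) ∧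
    QubitCoherence.IsIncoherentOperation QubitCoherence.cnotOperation ∧
    (∀ j : Fin 2, QubitCoherence.IsIncoherentState (QubitCoherence.basisState j)) ∧
    (∀ (ρ : QubitCoherence.QubitOp) (j : Fin 2), QubitCoherence.IsState ρ →
      QubitCoherence.concurrence
          (QubitCoherence.cnotOperation (ρ ⊗ₖ QubitCoherence.basisState j)) =
        QubitCoherence.l1Coherence ρ) := by
  refine ⟨fun ρ σ Φ => QubitCoherence.concurrence_incoherentOperation_le,
    QubitCoherence.cnotOperation_isIncoherentOperation,
    QubitCoherence.isIncoherentState_single, fun ρ j hρ => le_antisymm ?_ ?_⟩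
  · exact QubitCoherence.concurrence_incoherentOperation_le hρ
      (QubitCoherence.isIncoherentState_single j)
      QubitCoherence.cnotOperation_isIncoherentOperation
  · exact QubitCoherence.l1Coherence_le_concurrence_cnotOperation hρ j
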